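/- Let $K$ be a field. A planar forest is a finite (possibly empty) word $F=t_1\cdots t_n$ of planar rooted trees; the empty forest is denoted $1$. Let $\mathbf{F}$ be the set of planar forests and let $\mathcal{H}$ be the free associative unital $K$-algebra generated by the planar rooted trees, so that $\mathbf{F}$ is a $K$-basis of $\mathcal{H}$. Let $\bullet$ be the tree with a single vertex, and let $B^+(t_1\cdots t_n)$ be the tree obtained by grafting $t_1,\dots,t_n$, in this order from left to right, on a common new root; extend $B^+$ linearly to $\mathcal{H}$. Let $\varepsilon,\gamma$ be the linear maps on $\mathcal{H}$ given on forests by $\varepsilon(F)=\delta_{F,1}$, $\gamma(1)=0$ and $\gamma(t_1\cdots t_n)=\delta_{t_1,\bullet}\,t_2\cdots t_n$ for $n\ge 1$. Let $\Delta:\mathcal{H}\to\mathcal{H}\otimes\mathcal{H}$ be the unique linear map such that, for all $x,y\in\mathcal{H}$, $$\Delta(1)=1\otimes 1,\qquad \Delta(xy)=(x\otimes 1)\Delta(y)+\Delta(x)(1\otimes y)-x\otimes y,\qquad \Delta(B^+(x))=(\mathrm{Id}\otimes B^+)(\Delta(x))+B^+(x)\otimes 1,$$ and let $\langle-,-\rangle:\mathcal{H}\times\mathcal{H}\to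 K$ be the unique bilinear pairing such that, for all $x,y,z\in\mathcal{H}$, $$\langle 1,x\rangle=\varepsilon(x),\qquad \langle xy,z\rangle=\langle y\otimes x,\Delta(z)\rangle,\qquad \langle B^+(x),y\rangle=\langle x,\gamma(y)\rangle,$$ where $\langle y\otimes x,a\otimes b\rangle=\langle y,a\rangle\langle x,b\rangle$. An admissible transformation of a planar forest is one of the following two operations, which leave the rest of the forest unchanged. First kind: for a vertex $q$, a child $p$ of $q$ and the leftmost child $s$ of $p$, detach $s$ together with the whole subtree above it from $p$ and attach it to $q$, immediately to the left of $p$. Second kind: for a root $p$ of the forest and the leftmost child $s$ of $p$, detach $s$ together with the whole subtree above it from $p$ and make it a separate tree of the forest, immediately to the left of the tree of $p$. For $F,G\in\mathbf{F}$ write $F\le G$ if $G$ is obtained from $F$ by a finite (possibly empty) sequence of admissible transformations. Finally let $m:\mathbf{F}\to\mathbf{F}$ be the involution defined inductively by $m(1)=1$ and $m(B^+(F_1)F_2)=B^+(m(F_2))\,m(F_1)$ for $F_1,F_2\in\mathbf{F}$. Theorem. Let $F,G\in\mathbf{F}$. The following assertions are equivalent: 1. $\langle F,G\rangle\neq 0$;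 2. $\langle F,G\rangle=1$; 3. $m(G)\le F$. -/

import Mathlib

open scoped TensorProduct

/-- Planar rooted trees: a root together with the ordered (left to right) list of the
subtrees grafted on it. -/
inductive PlanarTree : Type
  | node : List PlanarTree → PlanarTree

/-- Planar forests: finite words of planar trees.  The empty word is the forest `1`. -/
abbrev PlanarForest : Type := List PlanarTree

namespace PlanarForest

open PlanarTree

/-- Every forest is empty or of the form `B⁺(F₁) F₂`. -/
theorem ind {P : PlanarForest → Prop} (h1 : P [])
    (h2 : ∀ F₁ F₂, P F₁ → P F₂ → P (node F₁ :: F₂)) : ∀ F, P F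
  | [] => h1
  | node F₁ :: F₂ => h2 F₁ F₂ (ind h1 h2 F₁) (ind h1 h2 F₂)

/-! ### Admissible transformations and the order -/

/-- Second kind: some tree `B⁺(s R)` of the forest (`s` is the leftmost subtree of its root)
is replaced by the two trees `s` and `B⁺(R)`; the trees on its left and on its right are
unchanged. -/
inductive SecondKind : PlanarForest → PlanarForest → Prop
  | move (L M : PlanarForest) (s : PlanarTree) (R : PlanarForest) :
      SecondKind (L ++ node (s :: R) :: M) (L ++ s :: node R :: M)

/-- First kind: at some vertex `q` of the forest (`here`: `q` is a root; `above`: `q` is not a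
root), with list of subtrees `L B⁺(s R) M`, this list is replaced by `L s B⁺(R) M`. The root of
`s` is the leftmost child of a child `p` of `q`, and becomes the child of `q` that stands just
to the left of `p`. -/
inductive FirstKind : PlanarForest → PlanarForest → Prop
  | here (X Y L M : PlanarForest) (s : PlanarTree) (R : PlanarForest) :
      FirstKind (X ++ node (L ++ node (s :: R) :: M) :: Y)
        (X ++ node (L ++ s :: node R :: M) :: Y)
  | above (X Y F G : PlanarForest) :
      FirstKind F G → FirstKind (X ++ node F :: Y) (X ++ node G :: Y)

/-- `G` is obtained from `F` by an admissible transformation. -/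
def Admissible (F G : PlanarForest) : Prop := FirstKind F G ∨ SecondKind F G

/-- The order on planar forests: `Le F G` means that `G` is obtained from `F` by a finite
(possibly empty) sequence of admissible transformations. -/
def Le (F G : PlanarForest) : Prop := Relation.ReflTransGen Admissible F G

/-! ### The involution -/

/-- `m(1) = 1` and `m(B⁺(F₁) F₂) = B⁺(m(F₂)) m(F₁)`. -/
def m : PlanarForest → PlanarForest
  | [] => []
  | node F₁ :: F₂ => node (m F₂) :: m F₁

theorem m_m (F : PlanarForest) : m (m F) = F := by
  induction F using ind with
  | h1 => simp [m]
  | h2 F₁ F₂ h₁ h₂ => simp [m, h₁, h₂]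

/-! ### The algebra of planar forests -/

noncomputable section

/-- The free associative unital algebra on the set of planar trees, with basis the forests. -/
abbrev Alg (K : Type*) [Field K] : Type _ := MonoidAlgebra K (FreeMonoid PlanarTree)

variable (K : Type*) [Field K]

/-- A forest, seen as a monomial of the algebra. -/
def mono (F : PlanarForest) : Alg K := MonoidAlgebra.single (FreeMonoid.ofList F) 1

variable {K} in
/-- The linear map with prescribed values on the basis of forests. -/
def linExt {M : Type*} [AddCommGroup M] [Module K M] (f : PlanarForest → M) : Alg K →ₗ[K] M :=
  Finsupp.linearCombination K (fun F : FreeMonoid PlanarTree => f F.toList) ∘ₗ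
    (MonoidAlgebra.coeffLinearEquiv K : Alg K ≃ₗ[K] _).toLinearMap

@[simp] theorem linExt_mono {M : Type*} [AddCommGroup M] [Module K M] (f : PlanarForest → M)
    (F : PlanarForest) : linExt f (mono K F) = f F := by
  simp [linExt, mono]

theorem mono_nil : mono K [] = 1 := rfl

theorem mono_append (F G : PlanarForest) : mono K (F ++ G) = mono K F * mono K G := by
  simp [mono, MonoidAlgebra.single_mul_single]

theorem mono_cons (t : PlanarTree) (G : PlanarForest) :
    mono K (t :: G) = mono K [t] * mono K G := mono_append K [t] G

variable {K} in
theorem hom_ext {M : Type*} [AddCommGroup M] [Module K M] {f g : Alg K →ₗ[K] M}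
    (h : ∀ F, f (mono K F) = g (mono K F)) : f = g := by
  apply MonoidAlgebra.lhom_ext'
  intro F
  ext
  exact h F.toList

/-- `B⁺`: graft the trees of a forest on a common new root. -/
def Bplus : Alg K →ₗ[K] Alg K := linExt fun F => mono K [node F]

/-- The counit `ε(F) = δ_{F,1}`. -/
def counit : Alg K →ₗ[K] K := linExt fun
  | [] => 1
  | _ :: _ => 0

/-- `γ(t₁ ⋯ tₙ) = t₂ ⋯ tₙ` if `t₁` is the tree with one vertex, and `0` otherwise
(in particular `γ(1) = 0`). -/
def gamma : Alg K →ₗ[K] Alg K := linExt fun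
  | node [] :: G => mono K G
  | _ => 0

/-- The infinitesimal coproduct of a forest: `Δ(1) = 1 ⊗ 1` and, with `t = B⁺(F)`,
`Δ(t G) = (t ⊗ 1) Δ(G) + Δ(t) (1 ⊗ G) - t ⊗ G`, where `Δ(t) = (Id ⊗ B⁺)(Δ(F)) + t ⊗ 1`. -/
def coprodForest : PlanarForest → Alg K ⊗[K] Alg K
  | [] => 1 ⊗ₜ 1
  | node F :: G =>
      (mono K [node F] ⊗ₜ 1) * coprodForest G
        + ((Bplus K).lTensor (Alg K) (coprodForest F) + mono K [node F] ⊗ₜ 1) * (1 ⊗ₜ mono K G)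
        - mono K [node F] ⊗ₜ mono K G

/-- The infinitesimal coproduct. -/
def coprod : Alg K →ₗ[K] Alg K ⊗[K] Alg K := linExt (coprodForest K)

variable {K} in
/-- For linear forms `f`, `g`, the linear form `x ⊗ y ↦ f(x) g(y)`. -/
def tensorForm (f g : Alg K →ₗ[K] K) : Alg K ⊗[K] Alg K →ₗ[K] K :=
  LinearMap.mul' K K ∘ₗ TensorProduct.map f g

/-- The linear form `⟨F, -⟩` of a forest: `⟨1, z⟩ = ε(z)` and
`⟨B⁺(F₁) F₂, z⟩ = ⟨F₂ ⊗ B⁺(F₁), Δ(z)⟩`, where `⟨B⁺(F₁), y⟩ = ⟨F₁, γ(y)⟩`. -/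
def pairingForest : PlanarForest → (Alg K →ₗ[K] K)
  | [] => counit K
  | node F₁ :: F₂ =>
      tensorForm (pairingForest F₂) (pairingForest F₁ ∘ₗ gamma K) ∘ₗ coprod K

/-- The pairing `⟨-, -⟩` on the algebra of planar forests. -/
def pairing : Alg K →ₗ[K] Alg K →ₗ[K] K := linExt (pairingForest K)

/-! ### The characteristic properties of the coproduct and of the pairing -/

@[simp] theorem tensorForm_tmul (f g : Alg K →ₗ[K] K) (x y : Alg K) :
    tensorForm f g (x ⊗ₜ y) = f x * g y := by simp [tensorForm]

theorem tensorForm_add_right (f g g' : Alg K →ₗ[K] K) :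
    tensorForm f (g + g') = tensorForm f g + tensorForm f g' := by
  rw [tensorForm, TensorProduct.map_add_right, LinearMap.comp_add]
  rfl

theorem tensorForm_add_left (f f' g : Alg K →ₗ[K] K) :
    tensorForm (f + f') g = tensorForm f g + tensorForm f' g := by
  rw [tensorForm, TensorProduct.map_add_left, LinearMap.comp_add]
  rfl

theorem tensorForm_smul_right (c : K) (f g : Alg K →ₗ[K] K) :
    tensorForm f (c • g) = c • tensorForm f g := by
  rw [tensorForm, TensorProduct.map_smul_right, LinearMap.comp_smul]
  rfl

theorem tensorForm_smul_left (c : K) (f g : Alg K →ₗ[K] K) :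
    tensorForm (c • f) g = c • tensorForm f g := by
  rw [tensorForm, TensorProduct.map_smul_left, LinearMap.comp_smul]
  rfl

@[simp] theorem Bplus_mono (F : PlanarForest) : Bplus K (mono K F) = mono K [node F] := by
  simp [Bplus]

theorem coprod_one : coprod K 1 = 1 ⊗ₜ 1 := by
  rw [← mono_nil, coprod, linExt_mono, coprodForest]; rfl

theorem coprod_Bplus (x : Alg K) :
    coprod K (Bplus K x) = (Bplus K).lTensor (Alg K) (coprod K x) + Bplus K x ⊗ₜ 1 := by
  have : coprod K ∘ₗ Bplus K = (Bplus K).lTensor (Alg K) ∘ₗ coprod K +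
      (TensorProduct.mk K (Alg K) (Alg K)).flip 1 ∘ₗ Bplus K := by
    apply hom_ext
    intro F
    simp [coprod, coprodForest, mono_nil, ← Algebra.TensorProduct.one_def]
  exact LinearMap.congr_fun this x

variable {K} in
theorem alg_ind {P : Alg K → Prop} (hm : ∀ F, P (mono K F)) (ha : ∀ x y, P x → P y → P (x + y))
    (hs : ∀ (c : K) x, P x → P (c • x)) (x : Alg K) : P x :=
  MonoidAlgebra.induction_on x (fun F => hm F.toList) ha hs

theorem coprod_cons_mul (F : PlanarForest) (y : Alg K) :
    coprod K (mono K [node F] * y) = (mono K [node F] ⊗ₜ 1) * coprod K y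
      + (Bplus K).lTensor (Alg K) (coprod K (mono K F)) * (1 ⊗ₜ y) := by
  induction y using alg_ind with
  | hm G =>
    rw [← mono_cons]
    simp [coprod, coprodForest, add_mul, Algebra.TensorProduct.tmul_mul_tmul]
    abel
  | ha x y hx hy =>
    simp only [mul_add, map_add, hx, hy, TensorProduct.tmul_add]
    abel
  | hs c x hx =>
    simp only [mul_smul_comm, map_smul, hx, TensorProduct.tmul_smul, smul_add]

theorem coprod_mul (x y : Alg K) :
    coprod K (x * y) = (x ⊗ₜ 1) * coprod K y + coprod K x * (1 ⊗ₜ y) - x ⊗ₜ y := by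
  induction x using alg_ind with
  | hm F =>
    induction F using ind with
    | h1 =>
      simp [mono_nil, coprod_one, ← Algebra.TensorProduct.one_def]
    | h2 F₁ F₂ _ h₂ =>
      have e1 : (mono K [node F₁] * mono K F₂) ⊗ₜ[K] (1 : Alg K)
          = (mono K [node F₁] ⊗ₜ 1) * (mono K F₂ ⊗ₜ 1) := by simp
      have e2 : (1 : Alg K) ⊗ₜ[K] (mono K F₂ * y) = (1 ⊗ₜ mono K F₂) * (1 ⊗ₜ y) := by simp
      have e3 : (mono K [node F₁] * mono K F₂) ⊗ₜ[K] y
          = (mono K [node F₁] ⊗ₜ 1) * (mono K F₂ ⊗ₜ y) := by simp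
      rw [mono_cons, mul_assoc, coprod_cons_mul, h₂, coprod_cons_mul, e1, e2, e3]
      simp only [mul_add, mul_sub, add_mul, mul_assoc]
      abel
  | ha x x' hx hx' =>
    simp only [add_mul, map_add, hx, hx', TensorProduct.add_tmul]
    abel
  | hs c x hx =>
    simp only [smul_mul_assoc, map_smul, hx, ← TensorProduct.smul_tmul', smul_add, smul_sub]

/-- `Δ` is the only linear map with the three characteristic relations. -/
theorem coprod_unique (D : Alg K →ₗ[K] Alg K ⊗[K] Alg K) (h1 : D 1 = 1 ⊗ₜ 1)
    (hm : ∀ x y, D (x * y) = (x ⊗ₜ 1) * D y + D x * (1 ⊗ₜ y) - x ⊗ₜ y)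
    (hB : ∀ x, D (Bplus K x) = (Bplus K).lTensor (Alg K) (D x) + Bplus K x ⊗ₜ 1) :
    D = coprod K := by
  apply hom_ext
  intro F
  induction F using ind with
  | h1 => rw [mono_nil, h1, coprod_one]
  | h2 F₁ F₂ h₁ h₂ =>
    rw [mono_cons, hm, coprod_mul, ← Bplus_mono, hB, coprod_Bplus, h₁, h₂]

@[simp] theorem counit_nil : counit K (mono K []) = 1 := by simp [counit]

@[simp] theorem counit_cons (t : PlanarTree) (F : PlanarForest) :
    counit K (mono K (t :: F)) = 0 := by simp [counit]

theorem counit_mul (x y : Alg K) : counit K (x * y) = counit K x * counit K y := by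
  induction x using alg_ind with
  | hm F =>
    induction y using alg_ind with
    | hm G =>
      rw [← mono_append]
      cases F <;> cases G <;> simp
    | ha y y' h h' => simp [mul_add, h, h']
    | hs c y h => simp [h, mul_left_comm]
  | ha x x' h h' => simp [add_mul, h, h']
  | hs c x h => simp [h, mul_assoc]

theorem counit_Bplus (x : Alg K) : counit K (Bplus K x) = 0 := by
  have : counit K ∘ₗ Bplus K = 0 := hom_ext fun F => by simp
  exact LinearMap.congr_fun this x

theorem gamma_Bplus (x : Alg K) : gamma K (Bplus K x) = counit K x • 1 := by
  have : gamma K ∘ₗ Bplus K = (counit K).smulRight 1 := hom_ext fun F => by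
    cases F <;> simp [gamma, mono_nil]
    simp [← mono_nil]
  exact LinearMap.congr_fun this x

theorem tensorForm_counit_right (f : Alg K →ₗ[K] K) (z : Alg K) :
    tensorForm f (counit K) (coprod K z) = f z := by
  induction z using alg_ind with
  | hm F =>
    induction F using ind generalizing f with
    | h1 => rw [mono_nil, coprod_one, tensorForm_tmul, ← mono_nil, counit_nil, mul_one]
    | h2 F₁ F₂ _ h₂ =>
      have e1 : ∀ W, tensorForm f (counit K) ((mono K [node F₁] ⊗ₜ (1 : Alg K)) * W)
          = tensorForm (f ∘ₗ LinearMap.mulLeft K (mono K [node F₁])) (counit K) W := by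
        intro W
        induction W with
        | zero => simp
        | tmul x y => simp
        | add x y hx hy => simp [mul_add, hx, hy]
      have e2 : ∀ W, tensorForm f (counit K)
          ((Bplus K).lTensor (Alg K) W * ((1 : Alg K) ⊗ₜ mono K F₂)) = 0 := by
        intro W
        induction W with
        | zero => simp
        | tmul x y => simp [counit_mul, counit_Bplus]
        | add x y hx hy => simp [add_mul, hx, hy]
      rw [mono_cons, coprod_cons_mul, map_add, e1, e2, h₂]
      simp
  | ha x y hx hy => simp [hx, hy]
  | hs c x hx => simp [hx]

theorem tensorForm_counit_left (f : Alg K →ₗ[K] K) (z : Alg K) :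
    tensorForm (counit K) f (coprod K z) = f z := by
  induction z using alg_ind with
  | hm F =>
    induction F using ind generalizing f with
    | h1 => rw [mono_nil, coprod_one, tensorForm_tmul, ← mono_nil, counit_nil, one_mul]
    | h2 F₁ F₂ h₁ _ =>
      have e1 : ∀ W, tensorForm (counit K) f ((mono K [node F₁] ⊗ₜ (1 : Alg K)) * W) = 0 := by
        intro W
        induction W with
        | zero => simp
        | tmul x y => simp [counit_mul]
        | add x y hx hy => simp [mul_add, hx, hy]
      have e2 : ∀ W, tensorForm (counit K) f
          ((Bplus K).lTensor (Alg K) W * ((1 : Alg K) ⊗ₜ mono K F₂))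
          = tensorForm (counit K) (f ∘ₗ LinearMap.mulRight K (mono K F₂) ∘ₗ Bplus K) W := by
        intro W
        induction W with
        | zero => simp
        | tmul x y => simp
        | add x y hx hy => simp [add_mul, hx, hy]
      rw [mono_cons, coprod_cons_mul, map_add, e1, e2, h₁]
      simp
  | ha x y hx hy => simp [hx, hy]
  | hs c x hx => simp [hx]

/-- Coassociativity of `Δ`, tested on linear forms. -/
theorem tensorForm_coassoc (f g h : Alg K →ₗ[K] K) (z : Alg K) :
    tensorForm (tensorForm f g ∘ₗ coprod K) h (coprod K z)
      = tensorForm f (tensorForm g h ∘ₗ coprod K) (coprod K z) := by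
  induction z using alg_ind with
  | hm F =>
    induction F using ind generalizing f h with
    | h1 => simp [mono_nil, coprod_one, mul_assoc]
    | h2 F₁ F₂ h₁ h₂ =>
      set t := mono K [node F₁] with ht
      set D := (Bplus K).lTensor (Alg K) (coprod K (mono K F₁)) with hD
      let ins : Alg K →ₗ[K] Alg K ⊗[K] Alg K :=
        LinearMap.mulLeft K D ∘ₗ TensorProduct.mk K (Alg K) (Alg K) 1
      have e1 : ∀ W, tensorForm (tensorForm f g ∘ₗ coprod K) h ((t ⊗ₜ (1 : Alg K)) * W)
          = tensorForm (tensorForm (f ∘ₗ LinearMap.mulLeft K t) g ∘ₗ coprod K) h W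
            + tensorForm (tensorForm f g ∘ₗ ins) h W := by
        have e0 : ∀ W, tensorForm f g ((t ⊗ₜ (1 : Alg K)) * W)
            = tensorForm (f ∘ₗ LinearMap.mulLeft K t) g W := by
          intro W
          induction W with
          | zero => simp
          | tmul x y => simp
          | add x y hx hy => simp [mul_add, hx, hy]
        intro W
        induction W with
        | zero => simp
        | tmul x y =>
          have e : coprod K (t * x) = (t ⊗ₜ 1) * coprod K x + ins x := coprod_cons_mul K F₁ x
          simp [e, e0, add_mul]
        | add x y hx hy =>
          simp only [mul_add, map_add, hx, hy]
          ring
      have e2 : ∀ W, tensorForm (tensorForm f g ∘ₗ coprod K) h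
          ((Bplus K).lTensor (Alg K) W * ((1 : Alg K) ⊗ₜ mono K F₂))
          = tensorForm (tensorForm f g ∘ₗ coprod K)
            (h ∘ₗ LinearMap.mulRight K (mono K F₂) ∘ₗ Bplus K) W := by
        intro W
        induction W with
        | zero => simp
        | tmul x y => simp
        | add x y hx hy => simp [add_mul, hx, hy]
      have e3 : ∀ W, tensorForm f (tensorForm g h ∘ₗ coprod K) ((t ⊗ₜ (1 : Alg K)) * W)
          = tensorForm (f ∘ₗ LinearMap.mulLeft K t) (tensorForm g h ∘ₗ coprod K) W := by
        intro W
        induction W with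
        | zero => simp
        | tmul x y => simp
        | add x y hx hy => simp [mul_add, hx, hy]
      have e5 : ∀ u : Alg K, coprod K (Bplus K u * mono K F₂)
          = (Bplus K u ⊗ₜ 1) * coprod K (mono K F₂)
            + (Bplus K).lTensor (Alg K) (coprod K u) * (1 ⊗ₜ mono K F₂) := by
        intro u
        rw [coprod_mul, coprod_Bplus, add_mul]
        simp [add_sub_assoc]
      have e6 : ∀ W, tensorForm g h
          ((Bplus K).lTensor (Alg K) W * ((1 : Alg K) ⊗ₜ mono K F₂))
          = tensorForm g (h ∘ₗ LinearMap.mulRight K (mono K F₂) ∘ₗ Bplus K) W := by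
        intro W
        induction W with
        | zero => simp
        | tmul x y => simp
        | add x y hx hy => simp [add_mul, hx, hy]
      let C := coprod K (mono K F₂)
      let ins' : Alg K →ₗ[K] Alg K ⊗[K] Alg K :=
        LinearMap.mulRight K C ∘ₗ (TensorProduct.mk K (Alg K) (Alg K)).flip 1 ∘ₗ Bplus K
      have e4 : ∀ W, tensorForm f (tensorForm g h ∘ₗ coprod K)
          ((Bplus K).lTensor (Alg K) W * ((1 : Alg K) ⊗ₜ mono K F₂))
          = tensorForm f (tensorForm g h ∘ₗ ins') W
            + tensorForm f (tensorForm g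
              (h ∘ₗ LinearMap.mulRight K (mono K F₂) ∘ₗ Bplus K) ∘ₗ coprod K) W := by
        intro W
        induction W with
        | zero => simp
        | tmul x y => simp [ins', C, e5, e6, mul_add]
        | add x y hx hy =>
          simp only [add_mul, map_add, hx, hy]
          ring
      have e7 : ∀ (V W : Alg K ⊗[K] Alg K),
          tensorForm (tensorForm f g ∘ₗ
            LinearMap.mulLeft K ((Bplus K).lTensor (Alg K) V) ∘ₗ
              TensorProduct.mk K (Alg K) (Alg K) 1) h W
          = tensorForm f (tensorForm g h ∘ₗ LinearMap.mulRight K W ∘ₗ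
              (TensorProduct.mk K (Alg K) (Alg K)).flip 1 ∘ₗ Bplus K) V := by
        intro V W
        induction W with
        | zero =>
          have : tensorForm g h ∘ₗ LinearMap.mulRight K (0 : Alg K ⊗[K] Alg K) ∘ₗ
              (TensorProduct.mk K (Alg K) (Alg K)).flip 1 ∘ₗ Bplus K = 0 := by
            apply LinearMap.ext
            simp
          rw [this]
          simp [tensorForm]
        | tmul x y =>
          induction V with
          | zero => simp
          | tmul x' y' => simp [mul_assoc]
          | add a b ha hb =>
            rw [map_add (tensorForm f _), ← ha, ← hb]
            simp [add_mul]
        | add c d hc hd =>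
          have : tensorForm g h ∘ₗ LinearMap.mulRight K (c + d) ∘ₗ
              (TensorProduct.mk K (Alg K) (Alg K)).flip 1 ∘ₗ Bplus K
              = tensorForm g h ∘ₗ LinearMap.mulRight K c ∘ₗ
                (TensorProduct.mk K (Alg K) (Alg K)).flip 1 ∘ₗ Bplus K
              + tensorForm g h ∘ₗ LinearMap.mulRight K d ∘ₗ
                (TensorProduct.mk K (Alg K) (Alg K)).flip 1 ∘ₗ Bplus K := by
            apply LinearMap.ext
            simp [mul_add]
          rw [map_add, hc, hd, this, tensorForm_add_right]
          rfl
      rw [mono_cons, coprod_cons_mul, map_add, map_add, e1, e2, e3, e4, h₁, h₂]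
      have := e7 (coprod K (mono K F₁)) C
      simp only [ins, ins', hD]
      rw [this]
      ring
  | ha x y hx hy => simp [hx, hy]
  | hs c x hx => simp [hx]

theorem pairing_one (z : Alg K) : pairing K 1 z = counit K z := by
  rw [← mono_nil, pairing, linExt_mono, pairingForest]

theorem pairing_mul (x y z : Alg K) :
    pairing K (x * y) z = tensorForm (pairing K y) (pairing K x) (coprod K z) := by
  have cons : ∀ (F : PlanarForest) (y z : Alg K), pairing K (mono K [node F] * y) z
      = tensorForm (pairing K y) (pairing K (mono K F) ∘ₗ gamma K) (coprod K z) := by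
    intro F y z
    induction y using alg_ind with
    | hm G => rw [← mono_cons]; simp [pairing, pairingForest]
    | ha y y' h h' => simp [mul_add, h, h', tensorForm_add_left]
    | hs c y h => simp [h, tensorForm_smul_left]
  induction x using alg_ind with
  | hm F =>
    induction F using ind generalizing z with
    | h1 =>
      have : pairing K (mono K []) = counit K := by simp [pairing, pairingForest]
      rw [this, mono_nil, one_mul, tensorForm_counit_right]
    | h2 F₁ F₂ _ h₂ =>
      have e1 : pairing K (mono K F₂ * y)
          = tensorForm (pairing K y) (pairing K (mono K F₂)) ∘ₗ coprod K :=
        LinearMap.ext h₂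
      have e2 : pairing K (mono K [node F₁] * mono K F₂)
          = tensorForm (pairing K (mono K F₂)) (pairing K (mono K F₁) ∘ₗ gamma K) ∘ₗ coprod K :=
        LinearMap.ext (cons F₁ (mono K F₂))
      rw [mono_cons, mul_assoc, cons, e1, e2, tensorForm_coassoc]
  | ha x x' h h' => simp [add_mul, h, h', tensorForm_add_right]
  | hs c x h => simp [h, tensorForm_smul_right]

theorem pairing_Bplus (x z : Alg K) : pairing K (Bplus K x) z = pairing K x (gamma K z) := by
  have : pairing K ∘ₗ Bplus K = (gamma K).lcomp K K ∘ₗ pairing K := by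
    apply hom_ext
    intro F
    ext z
    simp [pairing, pairingForest, tensorForm_counit_left]
  exact LinearMap.congr_fun (LinearMap.congr_fun this x) z

/-- `⟨-, -⟩` is the only pairing with the three characteristic properties. -/
theorem pairing_unique (B : Alg K →ₗ[K] Alg K →ₗ[K] K) (h1 : ∀ z, B 1 z = counit K z)
    (hm : ∀ x y z, B (x * y) z = tensorForm (B y) (B x) (coprod K z))
    (hB : ∀ x z, B (Bplus K x) z = B x (gamma K z)) : B = pairing K := by
  apply hom_ext
  intro F
  induction F using ind with
  | h1 => refine LinearMap.ext fun z => ?_; rw [mono_nil, h1, pairing_one]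
  | h2 F₁ F₂ h₁ h₂ =>
    have e : B (mono K [node F₁]) = pairing K (mono K [node F₁]) := by
      rw [← Bplus_mono]
      refine LinearMap.ext fun z => ?_
      rw [hB, pairing_Bplus, h₁]
    refine LinearMap.ext fun z => ?_
    rw [mono_cons, hm, pairing_mul, h₂, e]

end

end PlanarForest

/-! Both the order and the pairing obey the same recursion in `F = B⁺(F₁) F₂`. Order: `P ≤ B⁺(F₁)
F₂` iff some vertex of the leftmost branch of `P` carries a forest `C ≤ F₁` and its removal with `C`
leaves some `Q ≤ F₂` (`RecLe`, `recLe_iff_le`). Pairing: `⟨B⁺(F₁) F₂, G⟩` applies `⟨F₂, -⟩ ⊗ ⟨F₁,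
γ(-)⟩` to `Δ(G)`. Applying `γ` on the right leaves one term `XH ⊗ Y` for each way of writing `G = X
B⁺(H) Y`. The involution `m` turns the trees of `G` into the vertices of the leftmost branch of
`m(G)`: the vertex given by `B⁺(H)` carries `m(Y)`, and its removal leaves `m(XH)`. So the two
recursions agree with `P = m(G)`. The value is 0 or 1 in every characteristic: the forests carried
along a branch have distinct sizes and `C ≤ F₁` preserves size, so at most one term contributes
(`tensorForm_gamma_coprod_eq_ite`). -/

namespace PlanarForest

open PlanarTree

/-! ### The order -/

/-- The number of vertices of a forest. -/
def size : PlanarForest → ℕ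
  | [] => 0
  | node F₁ :: F₂ => size F₁ + size F₂ + 1

/-- `LeftBranch P C Q`: some vertex of the leftmost branch of `P` carries the forest `C`, and
`Q` is obtained from `P` by deleting this vertex together with `C`. -/
inductive LeftBranch : PlanarForest → PlanarForest → PlanarForest → Prop
  | root (C Q : PlanarForest) : LeftBranch (node C :: Q) C Q
  | above {P C Q : PlanarForest} (R : PlanarForest) :
      LeftBranch P C Q → LeftBranch (node P :: R) C (node Q :: R)

/-- A recursive description of the order on planar forests. -/
inductive RecLe : PlanarForest → PlanarForest → Prop
  | nil : RecLe [] []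
  | cons {P C Q F₁ F₂ : PlanarForest} :
      LeftBranch P C Q → RecLe C F₁ → RecLe Q F₂ → RecLe P (node F₁ :: F₂)

theorem LeftBranch.size_eq {P C Q : PlanarForest} (h : LeftBranch P C Q) :
    size P = size C + size Q + 1 := by
  induction h with
  | root C Q => simp [size]
  | above R _ ih => simp only [size]; omega

theorem RecLe.size_eq {P F : PlanarForest} (h : RecLe P F) : size P = size F := by
  induction h with
  | nil => rfl
  | cons hb _ _ h₁ h₂ => rw [hb.size_eq, h₁, h₂, size]

/-! ### Admissible transformations inside a larger forest -/

theorem FirstKind.append_left {F G : PlanarForest} (Z : PlanarForest) (h : FirstKind F G) :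
    FirstKind (Z ++ F) (Z ++ G) := by
  cases h with
  | here X Y L M s R => simpa using FirstKind.here (Z ++ X) Y L M s R
  | above X Y F G h => simpa using FirstKind.above (Z ++ X) Y F G h

theorem Admissible.cons {F G : PlanarForest} (t : PlanarTree) (h : Admissible F G) :
    Admissible (t :: F) (t :: G) := by
  rcases h with h | h
  · exact Or.inl (h.append_left [t])
  · cases h with
    | move L M s R => exact Or.inr (SecondKind.move (t :: L) M s R)

/-- Under a new root, former roots become children, so a move of the second kind becomes one of the
first kind. -/
theorem Admissible.node_cons {F G : PlanarForest} (Y : PlanarForest) (h : Admissible F G) :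
    Admissible (node F :: Y) (node G :: Y) := by
  rcases h with h | h
  · exact Or.inl (FirstKind.above [] Y F G h)
  · cases h with
    | move L M s R => exact Or.inl (FirstKind.here [] Y L M s R)

theorem Le.cons {F G : PlanarForest} (t : PlanarTree) (h : Le F G) : Le (t :: F) (t :: G) :=
  Relation.ReflTransGen.lift (t :: ·) (fun _ _ => Admissible.cons t) _ _ h

theorem Le.node_cons {F G : PlanarForest} (Y : PlanarForest) (h : Le F G) :
    Le (node F :: Y) (node G :: Y) :=
  Relation.ReflTransGen.lift (node · :: Y) (fun _ _ => Admissible.node_cons Y) _ _ h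

/-- The vertex carrying `C` descends the leftmost branch one level at a time; once it is the
leftmost child of a root, a move of the second kind frees it. -/
theorem LeftBranch.le {P C Q : PlanarForest} (h : LeftBranch P C Q) : Le P (node C :: Q) := by
  induction h with
  | root C Q => exact Relation.ReflTransGen.refl
  | @above P C Q R _ ih =>
    exact (ih.node_cons R).tail (Or.inr (SecondKind.move [] R (node C) Q))

theorem RecLe.le {P F : PlanarForest} (h : RecLe P F) : Le P F := by
  induction h with
  | nil => exact Relation.ReflTransGen.refl
  | cons hb _ _ h₁ h₂ => exact hb.le.trans ((h₁.node_cons _).trans (h₂.cons _))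

theorem RecLe.refl (F : PlanarForest) : RecLe F F := by
  induction F using ind with
  | h1 => exact .nil
  | h2 F₁ F₂ h₁ h₂ => exact .cons (.root F₁ F₂) h₁ h₂

/-- Two nested extractions can be exchanged: instead of taking out a vertex with `C` and then a
vertex inside `C`, the inner one is taken out of `P` first. -/
theorem RecLe.move_head {P : PlanarForest} {s : PlanarTree} {R M : PlanarForest}
    (h : RecLe P (node (s :: R) :: M)) : RecLe P (s :: node R :: M) := by
  obtain ⟨S⟩ := s
  cases h with
  | @cons _ C Q _ _ hb h₁ h₂ =>
    cases h₁ with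
    | @cons _ D C' _ _ hb' h₃ h₄ =>
      -- The leftmost branch of `C` continues that of `P` above the chosen vertex, so the vertex
      -- carrying `D` already lies on the leftmost branch of `P`.
      have key : ∀ {P C Q : PlanarForest}, LeftBranch P C Q → ∀ {D C' : PlanarForest},
          LeftBranch C D C' → ∃ P', LeftBranch P D P' ∧ LeftBranch P' C' Q := by
        intro P C Q h
        induction h with
        | root C Q => exact fun h' => ⟨_, h'.above Q, .root _ Q⟩
        | above R _ ih =>
          intro D C' h'
          obtain ⟨P', h₁, h₂⟩ := ih h'
          exact ⟨_, h₁.above R, h₂.above R⟩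
      obtain ⟨P', h₅, h₆⟩ := key hb hb'
      exact .cons h₅ h₃ (.cons h₆ h₄ h₂)

/-- The hypothesis must hold for all `P`, since each tree of `L` replaces `P` by what its extraction
leaves. -/
theorem RecLe.mono_right_append {A B : PlanarForest} (h : ∀ P, RecLe P A → RecLe P B)
    (L : PlanarForest) : ∀ P, RecLe P (L ++ A) → RecLe P (L ++ B) := by
  induction L with
  | nil => exact h
  | cons t L ih =>
    intro P hP
    cases hP with
    | cons hb h₁ h₂ => exact .cons hb h₁ (ih _ h₂)

theorem RecLe.mono_right_node {A B : PlanarForest} (h : ∀ P, RecLe P A → RecLe P B)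
    (X Y : PlanarForest) : ∀ P, RecLe P (X ++ node A :: Y) → RecLe P (X ++ node B :: Y) := by
  refine RecLe.mono_right_append (fun P hP => ?_) X
  cases hP with
  | cons hb h₁ h₂ => exact .cons hb (h _ h₁) h₂

theorem RecLe.move (L M : PlanarForest) (s : PlanarTree) (R : PlanarForest) :
    ∀ P, RecLe P (L ++ node (s :: R) :: M) → RecLe P (L ++ s :: node R :: M) :=
  RecLe.mono_right_append (fun _ => RecLe.move_head) L

theorem RecLe.firstKind {F G : PlanarForest} (h : FirstKind F G) :
    ∀ P, RecLe P F → RecLe P G := by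
  induction h with
  | here X Y L M s R => exact RecLe.mono_right_node (RecLe.move L M s R) X Y
  | above X Y F G _ ih => exact RecLe.mono_right_node ih X Y

theorem recLe_iff_le {P F : PlanarForest} : RecLe P F ↔ Le P F := by
  refine ⟨RecLe.le, fun h => ?_⟩
  induction h with
  | refl => exact RecLe.refl P
  | tail _ h ih =>
    rcases h with h | h
    · exact RecLe.firstKind h P ih
    · cases h with
      | move L M s R => exact RecLe.move L M s R P ih

/-! ### The pairing of two forests -/

section Pairing

variable (K : Type*) [Field K]

/-- Since `γ(B⁺(x) G) = ε(x) G`, the counit reduces the contribution of `Δ(H)` to the single term `H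
⊗ G`; the other terms come from `Δ(G)`, with `B⁺(H)` multiplied on the left. -/
theorem tensorForm_gamma_coprod_cons (f g : Alg K →ₗ[K] K) (H G : PlanarForest) :
    tensorForm f (g ∘ₗ gamma K) (coprod K (mono K (node H :: G)))
      = f (mono K H) * g (mono K G)
        + tensorForm (f ∘ₗ LinearMap.mulLeft K (mono K [node H])) (g ∘ₗ gamma K)
          (coprod K (mono K G)) := by
  have gamma_mul : ∀ x : Alg K,
      gamma K (Bplus K x * mono K G) = counit K x • mono K G := by
    intro x
    have : gamma K ∘ₗ LinearMap.mulRight K (mono K G) ∘ₗ Bplus K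
        = (counit K).smulRight (mono K G) := hom_ext fun F => by
      cases F <;> simp [← mono_cons, gamma]
    exact LinearMap.congr_fun this x
  have e1 : ∀ W, tensorForm f (g ∘ₗ gamma K) ((mono K [node H] ⊗ₜ (1 : Alg K)) * W)
      = tensorForm (f ∘ₗ LinearMap.mulLeft K (mono K [node H])) (g ∘ₗ gamma K) W := by
    intro W
    induction W with
    | zero => simp
    | tmul x y => simp
    | add x y hx hy => simp [mul_add, hx, hy]
  have e2 : ∀ W, tensorForm f (g ∘ₗ gamma K)
      ((Bplus K).lTensor (Alg K) W * ((1 : Alg K) ⊗ₜ mono K G))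
      = tensorForm f (counit K) W * g (mono K G) := by
    intro W
    induction W with
    | zero => simp
    | tmul x y => simp [gamma_mul, mul_assoc]
    | add x y hx hy => simp [add_mul, hx, hy]
  rw [mono_cons, coprod_cons_mul, map_add, e1, e2, tensorForm_counit_right, add_comm]

-- A sum over the trees of `G` becomes a search along the leftmost branch of `m G`. The form `f` and
-- predicate `p` vary in the induction, to absorb left multiplication by the first tree; the fixed
-- size `n` prevents two terms from contributing.
open scoped Classical in
theorem tensorForm_gamma_coprod_eq_ite (g : Alg K →ₗ[K] K) (q : PlanarForest → Prop) (n : ℕ)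
    (hq : ∀ C, q C → size C = n) (hg : ∀ X, g (mono K X) = if q (m X) then 1 else 0)
    (G : PlanarForest) (f : Alg K →ₗ[K] K) (p : PlanarForest → Prop)
    (hf : ∀ X, f (mono K X) = if p (m X) then 1 else 0) :
    tensorForm f (g ∘ₗ gamma K) (coprod K (mono K G))
      = if ∃ C Q, LeftBranch (m G) C Q ∧ q C ∧ p Q then 1 else 0 := by
  induction G using ind generalizing f p with
  | h1 =>
    have : ¬ ∃ C Q, LeftBranch (m []) C Q ∧ q C ∧ p Q := by
      rintro ⟨C, Q, h, -⟩
      rw [m] at h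
      cases h
    rw [if_neg this, mono_nil, coprod_one, tensorForm_tmul]
    simp [← mono_nil, gamma]
  | h2 H G _ ih =>
    have hf' : ∀ X, (f ∘ₗ LinearMap.mulLeft K (mono K [node H])) (mono K X)
        = if p (node (m X) :: m H) then 1 else 0 := by
      intro X
      rw [LinearMap.comp_apply, LinearMap.mulLeft_apply, ← mono_cons, hf, m]
    rw [tensorForm_gamma_coprod_cons, ih _ (fun P => p (node P :: m H)) hf', hf, hg, m]
    -- The vertex sought is either the leftmost root, matching the term `H ⊗ G`, or lies higher,
    -- matching a term of `Δ(G)`.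
    have split : (∃ C Q, LeftBranch (node (m G) :: m H) C Q ∧ q C ∧ p Q) ↔
        (p (m H) ∧ q (m G)) ∨ ∃ C Q, LeftBranch (m G) C Q ∧ q C ∧ p (node Q :: m H) := by
      constructor
      · rintro ⟨C, Q, h, hC, hQ⟩
        cases h with
        | root => exact Or.inl ⟨hQ, hC⟩
        | above _ h => exact Or.inr ⟨_, _, h, hC, hQ⟩
      · rintro (⟨h₁, h₂⟩ | ⟨C, Q, h, hC, hQ⟩)
        · exact ⟨_, _, .root _ _, h₂, h₁⟩
        · exact ⟨_, _, h.above _, hC, hQ⟩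
    -- A forest carried higher up the branch is strictly smaller than `m G`, so both cannot have
    -- size `n`; this rules out the value `1 + 1`.
    have excl : q (m G) → ¬ ∃ C Q, LeftBranch (m G) C Q ∧ q C ∧ p (node Q :: m H) := by
      rintro h ⟨C, Q, hb, hC, -⟩
      have := hb.size_eq
      have := hq _ h
      have := hq _ hC
      omega
    rw [if_congr split rfl rfl]
    by_cases h₁ : p (m H) <;> by_cases h₂ : q (m G)
    · simp [h₁, h₂, excl h₂]
    all_goals simp [h₁, h₂]

open scoped Classical in
theorem pairing_mono_mono (F G : PlanarForest) :
    pairing K (mono K F) (mono K G) = if Le (m G) F then 1 else 0 := by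
  simp only [← recLe_iff_le]
  induction F using ind generalizing G with
  | h1 =>
    rw [mono_nil, pairing_one]
    cases G with
    | nil => simp [m, RecLe.nil]
    | cons t G =>
      obtain ⟨H⟩ := t
      have : ¬ RecLe (m (node H :: G)) [] := by
        intro h
        rw [m] at h
        cases h
      rw [counit_cons, if_neg this]
  | h2 F₁ F₂ h₁ h₂ =>
    have e : pairing K (mono K [node F₁]) = pairing K (mono K F₁) ∘ₗ gamma K := by
      rw [← Bplus_mono]
      exact LinearMap.ext (pairing_Bplus K (mono K F₁))
    rw [mono_cons, pairing_mul, e,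
      tensorForm_gamma_coprod_eq_ite K _ (RecLe · F₁) (size F₁) (fun _ h => h.size_eq) h₁ G _
        (RecLe · F₂) h₂]
    generalize m G = P
    refine if_congr ⟨?_, fun h => ?_⟩ rfl rfl
    · rintro ⟨C, Q, hb, hC, hQ⟩
      exact .cons hb hC hQ
    · cases h with
      | cons hb hC hQ => exact ⟨_, _, hb, hC, hQ⟩

end Pairing

end PlanarForest

theorem mainTheorem3 (K : Type*) [Field K] (F G : PlanarForest) :
    List.TFAE
      [PlanarForest.pairing K (PlanarForest.mono K F) (PlanarForest.mono K G) ≠ 0,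
       PlanarForest.pairing K (PlanarForest.mono K F) (PlanarForest.mono K G) = 1,
       PlanarForest.Le (PlanarForest.m G) F] := by
  rw [PlanarForest.pairing_mono_mono]
  tfae_have 1 ↔ 3 := by simp
  tfae_have 2 ↔ 3 := by simp
  tfae_finish
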